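/- Let $q_0,q_1>1$ be real numbers with $q_0+q_1\ge q_0q_1$, and put $$I_Q=\Big[0,\tfrac1{q_1-1}\Big],\qquad r_Q=\frac{q_0}{q_1},\qquad \ell_Q=\frac{q_1}{q_0(q_1-1)}-1 .$$ The greedy map $G:I_Q\to I_Q$ is $G(x)=q_0x$ for $x\in[0,\frac1{q_1})$ and $G(x)=q_1x-1$ for $x\in[\frac1{q_1},\frac1{q_1-1}]$. The lazy map $L:I_Q\to I_Q$ is $L(x)=q_0x$ for $x\in[0,\frac1{q_0(q_1-1)}]$ and $L(x)=q_1x-1$ for $x\in(\frac1{q_0(q_1-1)},\frac1{q_1-1}]$. For $x\in I_Q$ and $n\ge1$, the $n$-th digit of the greedy expansion of $x$ is $0$ if $G^{n-1}(x)<\frac1{q_1}$ and $1$ otherwise; the $n$-th digit of the lazy expansion of $x$ is $0$ if $L^{n-1}(x)\le\frac1{q_0(q_1-1)}$ and $1$ otherwise. Let $s(n)$ be the sum of the first $n$ digits of the greedy expansion of $r_Q$, let $t(n)$ be the sum of the first $n$ digits of the lazy expansion of $\ell_Q$, and set $$\tilde h_{g,Q}(x)=\sum_{n=0}^{\infty}\frac{1}{q_1^{s(n)}q_0^{n-s(n)}}\,1_{[0,G^n(r_Q))}(x),\qquad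 \tilde h_{l,Q}(x)=\sum_{n=0}^{\infty}\frac{1}{q_0^{n-t(n)}q_1^{t(n)}}\,1_{(L^n(\ell_Q),\frac1{q_1-1}]}(x).$$ Then both series converge at every point. Moreover, among the probability measures on $I_Q$ that are absolutely continuous with respect to Lebesgue measure, exactly one is invariant under $G$ and exactly one is invariant under $L$; and their densities $h_{g,Q}$ and $h_{l,Q}$ with respect to Lebesgue measure on $I_Q$ are proportional to $\tilde h_{g,Q}$ and $\tilde h_{l,Q}$, respectively: there are constants $c_g,c_l>0$ with $h_{g,Q}=c_g\,\tilde h_{g,Q}$ and $h_{l,Q}=c_l\,\tilde h_{l,Q}$ almost everywhere on $I_Q$. -/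

import Mathlib

open MeasureTheory Set

noncomputable section

namespace DoubleBase

/-- The interval `I_Q = [0, 1/(q₁ - 1)]` of the double base `Q = (q₀, q₁)`. -/
def interval (q₁ : ℝ) : Set ℝ := Icc 0 (1 / (q₁ - 1))

/-- `r_Q = q₀ / q₁`. -/
def rPoint (q₀ q₁ : ℝ) : ℝ := q₀ / q₁

/-- `ℓ_Q = q₁ / (q₀ (q₁ - 1)) - 1`. -/
def lPoint (q₀ q₁ : ℝ) : ℝ := q₁ / (q₀ * (q₁ - 1)) - 1

/-- The greedy map: `q₀ x` on `[0, 1/q₁)` and `q₁ x - 1` on `[1/q₁, 1/(q₁ - 1)]`. It is written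
as a function on `ℝ`; only its restriction to `I_Q`, a self-map of `I_Q`, matters
(see `mapsTo_greedyMap`). -/
def greedyMap (q₀ q₁ x : ℝ) : ℝ := if x < 1 / q₁ then q₀ * x else q₁ * x - 1

/-- The lazy map: `q₀ x` on `[0, 1/(q₀ (q₁ - 1))]` and `q₁ x - 1` on
`(1/(q₀ (q₁ - 1)), 1/(q₁ - 1)]`. Again only its restriction to `I_Q` matters
(see `mapsTo_lazyMap`). -/
def lazyMap (q₀ q₁ x : ℝ) : ℝ := if x ≤ 1 / (q₀ * (q₁ - 1)) then q₀ * x else q₁ * x - 1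

/-- The digit number `i + 1` of the greedy expansion of `x`: it is `0` if
`G^i(x) ∈ [0, 1/q₁)` and `1` if `G^i(x) ∈ [1/q₁, 1/(q₁ - 1)]`. -/
def greedyDigit (q₀ q₁ x : ℝ) (i : ℕ) : ℕ :=
  if (greedyMap q₀ q₁)^[i] x < 1 / q₁ then 0 else 1

/-- The digit number `i + 1` of the lazy expansion of `x`: it is `0` if
`L^i(x) ∈ [0, 1/(q₀ (q₁ - 1))]` and `1` if `L^i(x) ∈ (1/(q₀ (q₁ - 1)), 1/(q₁ - 1)]`. -/
def lazyDigit (q₀ q₁ x : ℝ) (i : ℕ) : ℕ :=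
  if (lazyMap q₀ q₁)^[i] x ≤ 1 / (q₀ * (q₁ - 1)) then 0 else 1

/-- `s(n)`: the sum of the first `n` digits of the greedy expansion of `r_Q`. -/
def greedySum (q₀ q₁ : ℝ) (n : ℕ) : ℕ :=
  ∑ i ∈ Finset.range n, greedyDigit q₀ q₁ (rPoint q₀ q₁) i

/-- `t(n)`: the sum of the first `n` digits of the lazy expansion of `ℓ_Q`. -/
def lazySum (q₀ q₁ : ℝ) (n : ℕ) : ℕ :=
  ∑ i ∈ Finset.range n, lazyDigit q₀ q₁ (lPoint q₀ q₁) i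

/-- The `n`-th term of the greedy step function,
`q₁^{-s(n)} q₀^{-(n - s(n))} 1_{[0, G^n(r_Q))}(x)`. The subtraction in `ℕ` is a true one
by `greedySum_le`. -/
def greedyTerm (q₀ q₁ x : ℝ) (n : ℕ) : ℝ :=
  1 / (q₁ ^ greedySum q₀ q₁ n * q₀ ^ (n - greedySum q₀ q₁ n)) *
    (Ico 0 ((greedyMap q₀ q₁)^[n] (rPoint q₀ q₁))).indicator (fun _ => (1 : ℝ)) x

/-- The `n`-th term of the lazy step function,
`q₀^{-(n - t(n))} q₁^{-t(n)} 1_{(L^n(ℓ_Q), 1/(q₁ - 1)]}(x)`. The subtraction in `ℕ` is a true one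
by `lazySum_le`. -/
def lazyTerm (q₀ q₁ x : ℝ) (n : ℕ) : ℝ :=
  1 / (q₀ ^ (n - lazySum q₀ q₁ n) * q₁ ^ lazySum q₀ q₁ n) *
    (Ioc ((lazyMap q₀ q₁)^[n] (lPoint q₀ q₁)) (1 / (q₁ - 1))).indicator (fun _ => (1 : ℝ)) x

/-- The greedy step function. -/
def greedyStep (q₀ q₁ x : ℝ) : ℝ := ∑' n, greedyTerm q₀ q₁ x n

/-- The lazy step function. -/
def lazyStep (q₀ q₁ x : ℝ) : ℝ := ∑' n, lazyTerm q₀ q₁ x n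

/-- `μ` is an absolutely continuous (with respect to Lebesgue measure on `I`) probability measure
on `I` that is invariant under `T`. Absolute continuity with respect to the restriction of
Lebesgue measure to `I` also says that `μ` is carried by `I`. -/
structure IsACInvariant (I : Set ℝ) (T : ℝ → ℝ) (μ : Measure ℝ) : Prop where
  prob : IsProbabilityMeasure μ
  ac : μ ≪ volume.restrict I
  inv : MeasurePreserving T μ μ

theorem greedySum_le (q₀ q₁ : ℝ) (n : ℕ) : greedySum q₀ q₁ n ≤ n := by
  have h := Finset.sum_le_card_nsmul (Finset.range n)
    (greedyDigit q₀ q₁ (rPoint q₀ q₁)) 1 (fun i _ => by unfold greedyDigit; split_ifs <;> simp)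
  simpa [greedySum] using h

theorem lazySum_le (q₀ q₁ : ℝ) (n : ℕ) : lazySum q₀ q₁ n ≤ n := by
  have h := Finset.sum_le_card_nsmul (Finset.range n)
    (lazyDigit q₀ q₁ (lPoint q₀ q₁)) 1 (fun i _ => by unfold lazyDigit; split_ifs <;> simp)
  simpa [lazySum] using h

theorem mapsTo_greedyMap {q₀ q₁ : ℝ} (h₀ : 1 < q₀) (h₁ : 1 < q₁) (hQ : q₀ * q₁ ≤ q₀ + q₁) :
    MapsTo (greedyMap q₀ q₁) (interval q₁) (interval q₁) := by
  rintro x ⟨hx0, hx1⟩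
  have hp : 0 < q₁ - 1 := by linarith
  rw [le_div_iff₀ hp] at hx1
  unfold greedyMap interval
  split_ifs with h
  · rw [lt_div_iff₀ (by linarith)] at h
    refine ⟨by positivity, ?_⟩
    rw [le_div_iff₀ hp]
    have h2 : q₀ * (q₁ - 1) * (x * q₁) ≤ q₀ * (q₁ - 1) * 1 :=
      mul_le_mul_of_nonneg_left h.le (by positivity)
    nlinarith
  · rw [not_lt, div_le_iff₀ (by linarith)] at h
    refine ⟨by linarith, ?_⟩
    rw [le_div_iff₀ hp]
    nlinarith

theorem mapsTo_lazyMap {q₀ q₁ : ℝ} (h₀ : 1 < q₀) (h₁ : 1 < q₁) (hQ : q₀ * q₁ ≤ q₀ + q₁) :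
    MapsTo (lazyMap q₀ q₁) (interval q₁) (interval q₁) := by
  rintro x ⟨hx0, hx1⟩
  have hp : 0 < q₁ - 1 := by linarith
  rw [le_div_iff₀ hp] at hx1
  unfold lazyMap interval
  split_ifs with h
  · rw [le_div_iff₀ (by positivity)] at h
    refine ⟨by positivity, ?_⟩
    rw [le_div_iff₀ hp]
    linarith
  · rw [not_le, div_lt_iff₀ (by positivity)] at h
    have h3 : 1 ≤ q₁ * x := by
      by_contra hc
      push Not at hc
      have h4 : q₀ * (q₁ - 1) * (q₁ * x) ≤ q₀ * (q₁ - 1) * 1 :=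
        mul_le_mul_of_nonneg_left hc.le (by positivity)
      nlinarith
    refine ⟨by linarith, ?_⟩
    rw [le_div_iff₀ hp]
    nlinarith

end DoubleBase

end

/-! Let `w n` be the weights and `r n` the orbit of `r_Q`. The step function is the density of `m(s)
= ∑ w n * |s ∩ [0, r n)|`. Taking the preimage of `s` under `G` turns the `n`-th term into the
`(n+1)`-st, plus `w n * |s ∩ [0, r_Q)| / q₀` whenever the digit is `1`. The greedy expansion of
`r_Q` says that these `w n` sum to `q₀`, so the surplus restores exactly the term `n = 0`, and `m`
is invariant (`greedyMeasure_preimage`).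

Uniqueness follows from ergodicity. If `A` is invariant, the deviation of `|A ∩ [0, x)|` from a
linear function is divided by `q₀` or `q₁` when `x` is replaced by its preimage, hence vanishes. So
`A` has constant density in `[0, r_Q)`, and is null or conull there. By Poincaré recurrence every
absolutely continuous invariant measure lives on the trap `[0, r_Q)`, where Lebesgue measure is
dominated by `m`. It is therefore absolutely continuous with respect to an ergodic measure and must
equal its normalization.

The lazy case is the greedy case for `(q₁, q₀)`: an order-reversing affine reflection conjugates the
maps and exchanges the digits. -/

namespace DoubleBase

open Filter Topology

/-! ### Weights, orbit of `r_Q`, and Lebesgue measure of greedy preimages -/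

/-- The weight `q₁^{-s(n)} q₀^{-(n - s(n))}` of the `n`-th term of the greedy step function. -/
noncomputable def greedyWeight (q₀ q₁ : ℝ) (n : ℕ) : ℝ :=
  1 / (q₁ ^ greedySum q₀ q₁ n * q₀ ^ (n - greedySum q₀ q₁ n))

/-- The greedy orbit of `r_Q`. -/
noncomputable def greedyOrbit (q₀ q₁ : ℝ) (n : ℕ) : ℝ := (greedyMap q₀ q₁)^[n] (rPoint q₀ q₁)

theorem greedyTerm_eq (q₀ q₁ x : ℝ) (n : ℕ) :
    greedyTerm q₀ q₁ x n = greedyWeight q₀ q₁ n *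
      (Ico 0 (greedyOrbit q₀ q₁ n)).indicator (fun _ => (1 : ℝ)) x := rfl

@[simp]
theorem greedyOrbit_zero (q₀ q₁ : ℝ) : greedyOrbit q₀ q₁ 0 = rPoint q₀ q₁ := rfl

theorem greedyOrbit_succ (q₀ q₁ : ℝ) (n : ℕ) :
    greedyOrbit q₀ q₁ (n + 1) = greedyMap q₀ q₁ (greedyOrbit q₀ q₁ n) :=
  Function.iterate_succ_apply' _ _ _

@[simp]
theorem greedyWeight_zero (q₀ q₁ : ℝ) : greedyWeight q₀ q₁ 0 = 1 := by
  simp [greedyWeight, greedySum]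

/-- The weight is the reciprocal of the product of the slopes met along the orbit. -/
theorem greedyWeight_succ (q₀ q₁ : ℝ) (n : ℕ) :
    greedyWeight q₀ q₁ (n + 1) = greedyWeight q₀ q₁ n *
      (if greedyOrbit q₀ q₁ n < 1 / q₁ then q₀⁻¹ else q₁⁻¹) := by
  have hs : greedySum q₀ q₁ (n + 1) =
      greedySum q₀ q₁ n + greedyDigit q₀ q₁ (rPoint q₀ q₁) n := Finset.sum_range_succ _ _
  have hle := greedySum_le q₀ q₁ n
  unfold greedyWeight
  rw [hs]
  unfold greedyDigit greedyOrbit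
  split_ifs
  · rw [add_zero, Nat.sub_add_comm hle, pow_succ]
    simp only [one_div, mul_inv]
    ring
  · rw [Nat.add_sub_add_right, pow_succ]
    simp only [one_div, mul_inv]
    ring

theorem measurable_greedyMap (q₀ q₁ : ℝ) : Measurable (greedyMap q₀ q₁) :=
  Measurable.ite measurableSet_Iio (by fun_prop) (by fun_prop)

theorem volume_preimage_mul_sub {q : ℝ} (hq : 0 < q) (c : ℝ) (s : Set ℝ) :
    volume ((fun x => q * x - c) ⁻¹' s) = ENNReal.ofReal q⁻¹ * volume s := by
  have : (fun x => q * x - c) ⁻¹' s = (q * ·) ⁻¹' ((fun x => x + (-c)) ⁻¹' s) := by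
    ext x; simp [sub_eq_add_neg]
  rw [this, Real.volume_preimage_mul_left hq.ne', measure_preimage_add_right,
    abs_of_pos (inv_pos.2 hq)]

section

variable {q₀ q₁ : ℝ} (h₀ : 1 < q₀) (h₁ : 1 < q₁)

include h₀ h₁

theorem rPoint_pos : 0 < rPoint q₀ q₁ := by
  unfold rPoint; positivity

theorem greedyWeight_pos (n : ℕ) : 0 < greedyWeight q₀ q₁ n := by
  unfold greedyWeight; positivity

theorem greedyWeight_le (n : ℕ) : greedyWeight q₀ q₁ n ≤ (max q₀⁻¹ q₁⁻¹) ^ n := by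
  induction n with
  | zero => simp
  | succ n ih =>
    rw [greedyWeight_succ, pow_succ]
    have := greedyWeight_pos h₀ h₁ n
    gcongr
    split_ifs <;> simp

theorem max_inv_lt_one : max q₀⁻¹ q₁⁻¹ < 1 :=
  max_lt (inv_lt_one_of_one_lt₀ h₀) (inv_lt_one_of_one_lt₀ h₁)

omit h₁ in
theorem max_inv_nonneg : 0 ≤ max q₀⁻¹ q₁⁻¹ :=
  le_max_of_le_left (by positivity)

theorem summable_greedyWeight : Summable (greedyWeight q₀ q₁) :=
  .of_nonneg_of_le (fun n => (greedyWeight_pos h₀ h₁ n).le) (greedyWeight_le h₀ h₁)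
    (summable_geometric_of_lt_one (max_inv_nonneg h₀) (max_inv_lt_one h₀ h₁))

theorem greedyTerm_nonneg (x : ℝ) (n : ℕ) : 0 ≤ greedyTerm q₀ q₁ x n :=
  mul_nonneg (greedyWeight_pos h₀ h₁ n).le (indicator_nonneg (fun _ _ => zero_le_one) _)

theorem summable_greedyTerm (x : ℝ) : Summable (greedyTerm q₀ q₁ x) := by
  refine .of_nonneg_of_le (greedyTerm_nonneg h₀ h₁ x) (fun n => ?_) (summable_greedyWeight h₀ h₁)
  rw [greedyTerm_eq]
  refine mul_le_of_le_one_right (greedyWeight_pos h₀ h₁ n).le ?_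
  exact indicator_le_self' (fun _ _ => zero_le_one) x |>.trans le_rfl

theorem one_div_lt_rPoint : 1 / q₁ < rPoint q₀ q₁ := by
  unfold rPoint; gcongr

omit h₁ in
theorem volume_preimage_greedyMap_inter_of_le {b : ℝ} (hb : b ≤ 1 / q₁) (s : Set ℝ) :
    volume (greedyMap q₀ q₁ ⁻¹' s ∩ Ico 0 b) =
      ENNReal.ofReal q₀⁻¹ * volume (s ∩ Ico 0 (q₀ * b)) := by
  have hq : 0 < q₀ := by linarith
  rw [← volume_preimage_mul_sub hq 0]
  congr 1
  ext x
  simp only [mem_inter_iff, mem_preimage, mem_Ico, sub_zero, mul_nonneg_iff_of_pos_left hq,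
    mul_lt_mul_iff_right₀ hq, and_congr_left_iff, and_imp]
  intro _ hx
  rw [greedyMap, if_pos (hx.trans_le hb)]

/-- The branch of slope `q₀` maps `[0, 1/q₁)` onto `[0, r_Q)`, and the branch of slope `q₁` maps
`[1/q₁, b)` onto `[0, q₁ b - 1)`. -/
theorem volume_preimage_greedyMap_inter_of_ge {b : ℝ} (hb : 1 / q₁ ≤ b) {s : Set ℝ}
    (hs : MeasurableSet s) :
    volume (greedyMap q₀ q₁ ⁻¹' s ∩ Ico 0 b) =
      ENNReal.ofReal q₀⁻¹ * volume (s ∩ Ico 0 (rPoint q₀ q₁)) +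
      ENNReal.ofReal q₁⁻¹ * volume (s ∩ Ico 0 (q₁ * b - 1)) := by
  have hq : 0 < q₁ := by linarith
  have hr : rPoint q₀ q₁ = q₀ * (1 / q₁) := by rw [rPoint]; ring
  rw [hr, ← volume_preimage_greedyMap_inter_of_le h₀ le_rfl,
    ← volume_preimage_mul_sub hq 1,
    ← Ico_union_Ico_eq_Ico (b := 1 / q₁) (by positivity) hb, inter_union_distrib_left,
    measure_union]
  · congr 2
    ext x
    simp only [mem_inter_iff, mem_preimage, mem_Ico, sub_nonneg, sub_lt_sub_iff_right,
      mul_lt_mul_iff_right₀ hq, div_le_iff₀' hq]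
    constructor
    · rintro ⟨h, hx, hx'⟩
      rw [greedyMap, if_neg (by rwa [not_lt, div_le_iff₀' hq])] at h
      exact ⟨h, hx, hx'⟩
    · rintro ⟨h, hx, hx'⟩
      rw [greedyMap, if_neg (by rwa [not_lt, div_le_iff₀' hq])]
      exact ⟨h, hx, hx'⟩
  · refine Disjoint.mono inter_subset_right inter_subset_right ?_
    rw [Ico_disjoint_Ico]
    simp
  · exact (measurable_greedyMap q₀ q₁ hs).inter measurableSet_Ico

variable (hQ : q₀ * q₁ ≤ q₀ + q₁)

include hQ

omit h₀ in
theorem rPoint_le : rPoint q₀ q₁ ≤ 1 / (q₁ - 1) := by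
  have : 0 < q₁ - 1 := by linarith
  rw [rPoint, div_le_div_iff₀ (by linarith) this]
  linarith

/-- The lower branch stays below `q₀ * (1/q₁) = r_Q`. The upper branch moves points left, since its
fixed point `1/(q₁ - 1)` is at least `r_Q`. -/
theorem mapsTo_greedyMap_Icc :
    MapsTo (greedyMap q₀ q₁) (Icc 0 (rPoint q₀ q₁)) (Icc 0 (rPoint q₀ q₁)) := by
  rintro x ⟨hx0, hx⟩
  have hq : 0 < q₁ := by linarith
  have hr := rPoint_le h₁ hQ
  rw [le_div_iff₀ (by linarith)] at hr
  unfold greedyMap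
  split_ifs with h
  · refine ⟨by positivity, ?_⟩
    rw [rPoint, div_eq_mul_one_div]
    gcongr
  · rw [not_lt, div_le_iff₀ hq] at h
    exact ⟨by linarith, by nlinarith⟩

theorem greedyOrbit_mem (n : ℕ) : greedyOrbit q₀ q₁ n ∈ Icc 0 (rPoint q₀ q₁) :=
  (mapsTo_greedyMap_Icc h₀ h₁ hQ).iterate n ⟨(rPoint_pos h₀ h₁).le, le_rfl⟩

theorem tendsto_greedyWeight_mul_greedyOrbit :
    Tendsto (fun n => greedyWeight q₀ q₁ n * greedyOrbit q₀ q₁ n) atTop (𝓝 0) := by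
  refine squeeze_zero (g := fun n => greedyWeight q₀ q₁ n * rPoint q₀ q₁)
    (fun n => mul_nonneg (greedyWeight_pos h₀ h₁ n).le (greedyOrbit_mem h₀ h₁ hQ n).1)
    (fun n => mul_le_mul_of_nonneg_left (greedyOrbit_mem h₀ h₁ hQ n).2
      (greedyWeight_pos h₀ h₁ n).le) ?_
  simpa using (summable_greedyWeight h₀ h₁).tendsto_atTop_zero.mul_const (rPoint q₀ q₁)

/-- The greedy expansion of `r_Q`, multiplied by `q₁`. -/
theorem hasSum_greedyWeight_digit_one :
    HasSum (fun n => if greedyOrbit q₀ q₁ n < 1 / q₁ then 0 else greedyWeight q₀ q₁ n) q₀ := by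
  rw [hasSum_iff_tendsto_nat_of_nonneg
    (fun n => by split_ifs; exacts [le_rfl, (greedyWeight_pos h₀ h₁ n).le])]
  -- Telescoping: the slope cancels in `w (n+1) * r (n+1)`, leaving `w n / q₁` exactly when the
  -- digit is `1`. The initial term is `q₁ * r_Q = q₀`.
  have key : ∀ n, (if greedyOrbit q₀ q₁ n < 1 / q₁ then 0 else greedyWeight q₀ q₁ n) =
      q₁ * (greedyWeight q₀ q₁ n * greedyOrbit q₀ q₁ n) -
      q₁ * (greedyWeight q₀ q₁ (n + 1) * greedyOrbit q₀ q₁ (n + 1)) := by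
    intro n
    rw [greedyWeight_succ, greedyOrbit_succ, greedyMap]
    split_ifs
    · field_simp; ring
    · field_simp; ring
  simp_rw [key, Finset.sum_range_sub' (fun n => q₁ * (greedyWeight q₀ q₁ n * greedyOrbit q₀ q₁ n))]
  convert ((tendsto_greedyWeight_mul_greedyOrbit h₀ h₁ hQ).const_mul q₁).const_sub
    (q₁ * (greedyWeight q₀ q₁ 0 * greedyOrbit q₀ q₁ 0)) using 2
  simp only [greedyWeight_zero, greedyOrbit_zero, rPoint]
  field_simp
  simp

end

/-! ### The invariant measure of the greedy map -/

/-- The measure with density the greedy step function. -/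
noncomputable def greedyMeasure (q₀ q₁ : ℝ) : Measure ℝ :=
  (volume.restrict (interval q₁)).withDensity fun x => ENNReal.ofReal (greedyStep q₀ q₁ x)

theorem measurable_greedyTerm (q₀ q₁ : ℝ) (n : ℕ) :
    Measurable fun x => greedyTerm q₀ q₁ x n :=
  (measurable_const.indicator measurableSet_Ico).const_mul _

section

variable {q₀ q₁ : ℝ} (h₀ : 1 < q₀) (h₁ : 1 < q₁)

include h₀ h₁

theorem ofReal_greedyStep (x : ℝ) :
    ENNReal.ofReal (greedyStep q₀ q₁ x) = ∑' n, ENNReal.ofReal (greedyTerm q₀ q₁ x n) :=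
  ENNReal.ofReal_tsum_of_nonneg (greedyTerm_nonneg h₀ h₁ x) (summable_greedyTerm h₀ h₁ x)

theorem measurable_ofReal_greedyStep :
    Measurable fun x => ENNReal.ofReal (greedyStep q₀ q₁ x) := by
  simp_rw [ofReal_greedyStep h₀ h₁]
  exact Measurable.tsum fun n => (measurable_greedyTerm q₀ q₁ n).ennreal_ofReal

variable (hQ : q₀ * q₁ ≤ q₀ + q₁)

include hQ

theorem greedyMeasure_apply {s : Set ℝ} (hs : MeasurableSet s) :
    greedyMeasure q₀ q₁ s = ∑' n, ENNReal.ofReal (greedyWeight q₀ q₁ n) *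
      volume (s ∩ Ico 0 (greedyOrbit q₀ q₁ n)) := by
  rw [greedyMeasure, withDensity_apply _ hs]
  simp_rw [ofReal_greedyStep h₀ h₁]
  rw [lintegral_tsum fun n => (measurable_greedyTerm q₀ q₁ n).ennreal_ofReal.aemeasurable]
  congr 1 with n
  have hterm : ∀ x, ENNReal.ofReal (greedyTerm q₀ q₁ x n) =
      (Ico 0 (greedyOrbit q₀ q₁ n)).indicator
        (fun _ => ENNReal.ofReal (greedyWeight q₀ q₁ n)) x := by
    intro x
    rw [greedyTerm_eq]
    by_cases hx : x ∈ Ico 0 (greedyOrbit q₀ q₁ n) <;> simp [hx]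
  simp_rw [hterm]
  rw [lintegral_indicator_const measurableSet_Ico, Measure.restrict_apply measurableSet_Ico,
    Measure.restrict_apply (measurableSet_Ico.inter hs), inter_comm s, inter_eq_left.2]
  exact fun x hx => ⟨hx.1.1, hx.1.2.le.trans
    ((greedyOrbit_mem h₀ h₁ hQ n).2.trans (rPoint_le h₁ hQ))⟩

/-- The surplus terms add up to `q₀ * q₀⁻¹ * V = V`, which is the term `n = 0` missing from the
shifted series. -/
theorem greedyMeasure_preimage {s : Set ℝ} (hs : MeasurableSet s) :
    greedyMeasure q₀ q₁ (greedyMap q₀ q₁ ⁻¹' s) = greedyMeasure q₀ q₁ s := by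
  rw [greedyMeasure_apply h₀ h₁ hQ (measurable_greedyMap q₀ q₁ hs),
    greedyMeasure_apply h₀ h₁ hQ hs]
  set V := volume (s ∩ Ico 0 (rPoint q₀ q₁)) with hV
  have key : ∀ n, ENNReal.ofReal (greedyWeight q₀ q₁ n) *
      volume (greedyMap q₀ q₁ ⁻¹' s ∩ Ico 0 (greedyOrbit q₀ q₁ n)) =
      ENNReal.ofReal (if greedyOrbit q₀ q₁ n < 1 / q₁ then 0 else greedyWeight q₀ q₁ n) *
        (ENNReal.ofReal q₀⁻¹ * V) +
      ENNReal.ofReal (greedyWeight q₀ q₁ (n + 1)) *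
        volume (s ∩ Ico 0 (greedyOrbit q₀ q₁ (n + 1))) := by
    intro n
    have hw := (greedyWeight_pos h₀ h₁ n).le
    rw [greedyWeight_succ, greedyOrbit_succ, greedyMap, ENNReal.ofReal_mul hw]
    split_ifs with h
    · rw [volume_preimage_greedyMap_inter_of_le h₀ h.le]
      simp [mul_assoc]
    · rw [volume_preimage_greedyMap_inter_of_ge h₀ h₁ (not_lt.1 h) hs]
      ring
  simp_rw [key]
  have hd := hasSum_greedyWeight_digit_one h₀ h₁ hQ
  rw [ENNReal.tsum_add, ENNReal.tsum_mul_right, ← ENNReal.ofReal_tsum_of_nonneg _ hd.summable,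
    hd.tsum_eq, ← mul_assoc, ← ENNReal.ofReal_mul (by linarith), mul_inv_cancel₀ (by linarith),
    tsum_eq_zero_add' (f := fun n => ENNReal.ofReal (greedyWeight q₀ q₁ n) *
      volume (s ∩ Ico 0 (greedyOrbit q₀ q₁ n))) ENNReal.summable]
  · simp [hV]
  · intro n
    split_ifs
    exacts [le_rfl, (greedyWeight_pos h₀ h₁ n).le]

theorem measurePreserving_greedyMap :
    MeasurePreserving (greedyMap q₀ q₁) (greedyMeasure q₀ q₁) (greedyMeasure q₀ q₁) := by
  refine ⟨measurable_greedyMap q₀ q₁, Measure.ext fun s hs => ?_⟩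
  rw [Measure.map_apply (measurable_greedyMap q₀ q₁) hs, greedyMeasure_preimage h₀ h₁ hQ hs]

theorem greedyMeasure_univ_ne_top : greedyMeasure q₀ q₁ univ ≠ ⊤ := by
  rw [greedyMeasure_apply h₀ h₁ hQ .univ]
  have : ∀ n, ENNReal.ofReal (greedyWeight q₀ q₁ n) *
      volume (univ ∩ Ico 0 (greedyOrbit q₀ q₁ n)) ≤
      ENNReal.ofReal (greedyWeight q₀ q₁ n) * ENNReal.ofReal (rPoint q₀ q₁) := by
    intro n
    rw [univ_inter, Real.volume_Ico, sub_zero]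
    gcongr
    exact (greedyOrbit_mem h₀ h₁ hQ n).2
  refine ne_top_of_le_ne_top ?_ (ENNReal.tsum_le_tsum this)
  rw [ENNReal.tsum_mul_right, ← ENNReal.ofReal_tsum_of_nonneg
    (fun n => (greedyWeight_pos h₀ h₁ n).le) (summable_greedyWeight h₀ h₁)]
  exact ENNReal.mul_ne_top ENNReal.ofReal_ne_top ENNReal.ofReal_ne_top

/-- The term `n = 0` alone gives the bound. -/
theorem volume_inter_le_greedyMeasure {s : Set ℝ} (hs : MeasurableSet s) :
    volume (s ∩ Ico 0 (rPoint q₀ q₁)) ≤ greedyMeasure q₀ q₁ s := by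
  rw [greedyMeasure_apply h₀ h₁ hQ hs]
  refine le_trans ?_ (ENNReal.le_tsum 0)
  simp

theorem greedyMeasure_univ_ne_zero : greedyMeasure q₀ q₁ univ ≠ 0 := by
  have := volume_inter_le_greedyMeasure h₀ h₁ hQ .univ
  rw [univ_inter, Real.volume_Ico, sub_zero] at this
  exact (lt_of_lt_of_le (ENNReal.ofReal_pos.2 (rPoint_pos h₀ h₁)) this).ne'

theorem greedyMeasure_eq_zero {s : Set ℝ} (hs : MeasurableSet s)
    (h : volume (s ∩ Ico 0 (rPoint q₀ q₁)) = 0) : greedyMeasure q₀ q₁ s = 0 := by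
  rw [greedyMeasure_apply h₀ h₁ hQ hs, ENNReal.tsum_eq_zero]
  intro n
  rw [measure_mono_null _ h, mul_zero]
  exact inter_subset_inter_right _ (Ico_subset_Ico_right (greedyOrbit_mem h₀ h₁ hQ n).2)

/-! ### Ergodicity -/

/-- The distribution function of an invariant set is linear on `[0, r_Q]`: its deviation `F` from
the linear function satisfies `F(x) = F(G(x)) / q` with `q = q₀` or `q = q₁`. -/
theorem volume_inter_Ico_of_preimage_eq {A : Set ℝ} (hA : MeasurableSet A)
    (hinv : greedyMap q₀ q₁ ⁻¹' A = A) {x : ℝ} (hx : x ∈ Icc 0 (rPoint q₀ q₁)) :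
    volume.real (A ∩ Ico 0 x) =
      volume.real (A ∩ Ico 0 (rPoint q₀ q₁)) / rPoint q₀ q₁ * x := by
  set r := rPoint q₀ q₁ with hr
  have hrpos : 0 < r := rPoint_pos h₀ h₁
  set ρ := volume.real (A ∩ Ico 0 r) / r with hρ
  have hfin : ∀ b, volume (A ∩ Ico 0 b) ≠ ⊤ := fun b =>
    ne_top_of_le_ne_top measure_Ico_lt_top.ne (measure_mono inter_subset_right)
  set F : ℝ → ℝ := fun y => volume.real (A ∩ Ico 0 y) - ρ * y with hF
  have hρr : ρ * r = volume.real (A ∩ Ico 0 r) := div_mul_cancel₀ _ hrpos.ne'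
  have step : ∀ y ∈ Icc 0 r, |F y| ≤ max q₀⁻¹ q₁⁻¹ * |F (greedyMap q₀ q₁ y)| := by
    intro y hy
    suffices h : F y = q₀⁻¹ * F (greedyMap q₀ q₁ y) ∨ F y = q₁⁻¹ * F (greedyMap q₀ q₁ y) by
      rcases h with h | h
      · rw [h, abs_mul, abs_of_pos (by positivity)]
        gcongr
        exact le_max_left _ _
      · rw [h, abs_mul, abs_of_pos (by positivity)]
        gcongr
        exact le_max_right _ _
    rw [greedyMap]
    split_ifs with h
    · left
      have := volume_preimage_greedyMap_inter_of_le h₀ h.le A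
      rw [hinv] at this
      simp only [hF, Measure.real]
      rw [this, ENNReal.toReal_mul, ENNReal.toReal_ofReal (by positivity)]
      field_simp
    -- The contribution of the lower branch is `ρ * r / q₀ = ρ / q₁`, which cancels the translation
    -- by `1` in the upper branch.
    · right
      have := volume_preimage_greedyMap_inter_of_ge h₀ h₁ (not_lt.1 h) hA
      rw [hinv] at this
      simp only [hF, Measure.real]
      rw [this, ENNReal.toReal_add (ENNReal.mul_ne_top ENNReal.ofReal_ne_top (hfin _))
        (ENNReal.mul_ne_top ENNReal.ofReal_ne_top (hfin _)), ENNReal.toReal_mul,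
        ENNReal.toReal_mul, ENNReal.toReal_ofReal (by positivity),
        ENNReal.toReal_ofReal (by positivity), ← Measure.real, ← hr, ← hρr, hr, rPoint]
      field_simp
      ring
  have bound : ∀ y ∈ Icc 0 r, |F y| ≤ r + |ρ| * r := by
    intro y hy
    refine (abs_sub _ _).trans (add_le_add ?_ ?_)
    · rw [abs_of_nonneg measureReal_nonneg]
      calc volume.real (A ∩ Ico 0 y) ≤ volume.real (Ico 0 y) :=
            measureReal_mono inter_subset_right measure_Ico_lt_top.ne
        _ ≤ r := by simp [hy.1, hy.2]
    · rw [abs_mul, abs_of_nonneg hy.1]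
      gcongr
      exact hy.2
  -- `F` is bounded on the forward-invariant interval `[0, r]`, so iterating the contraction forces
  -- it to vanish.
  have iter : ∀ n : ℕ, ∀ y ∈ Icc 0 r, |F y| ≤ max q₀⁻¹ q₁⁻¹ ^ n * (r + |ρ| * r) := by
    intro n
    induction n with
    | zero => simpa using bound
    | succ n ih =>
      intro y hy
      refine (step y hy).trans ?_
      rw [pow_succ', mul_assoc]
      exact mul_le_mul_of_nonneg_left (ih _ (mapsTo_greedyMap_Icc h₀ h₁ hQ hy))
        (max_inv_nonneg h₀)
  have hlim : Tendsto (fun n : ℕ => max q₀⁻¹ q₁⁻¹ ^ n * (r + |ρ| * r)) atTop (𝓝 0) := by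
    simpa using (tendsto_pow_atTop_nhds_zero_of_lt_one (max_inv_nonneg h₀)
      (max_inv_lt_one h₀ h₁)).mul_const (r + |ρ| * r)
  have h0 : |F x| ≤ 0 := ge_of_tendsto' hlim fun n => iter n x hx
  exact sub_eq_zero.1 (abs_nonpos_iff.1 h0)

/-- Having the same density `ρ` in every `[0, x)`, the set `A` has it in every measurable subset of
`[0, r_Q)`. Testing on `A` itself leaves only measure zero or `ρ = 1`; in the latter case testing on
`Aᶜ` gives zero. -/
theorem volume_inter_or_compl_inter_eq_zero {A : Set ℝ} (hA : MeasurableSet A)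
    (hinv : greedyMap q₀ q₁ ⁻¹' A = A) :
    volume (A ∩ Ico 0 (rPoint q₀ q₁)) = 0 ∨ volume (Aᶜ ∩ Ico 0 (rPoint q₀ q₁)) = 0 := by
  have hlin := fun x (hx : x ∈ Icc 0 (rPoint q₀ q₁)) =>
    volume_inter_Ico_of_preimage_eq h₀ h₁ hQ hA hinv hx
  set r := rPoint q₀ q₁ with hr
  have hrpos : 0 < r := rPoint_pos h₀ h₁
  set ρ := volume.real (A ∩ Ico 0 r) / r with hρ
  have hρ0 : 0 ≤ ρ := by positivity
  have hfin : ∀ b, volume (A ∩ Ico 0 b) ≠ ⊤ := fun b =>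
    ne_top_of_le_ne_top measure_Ico_lt_top.ne (measure_mono inter_subset_right)
  have hlin' : ∀ x ∈ Icc 0 r, volume (A ∩ Ico 0 x) = ENNReal.ofReal ρ * volume (Ico 0 x) := by
    intro x hx
    rw [Real.volume_Ico, sub_zero, ← ENNReal.ofReal_mul hρ0, ← hlin x hx,
      ofReal_measureReal (hfin x)]
  have : IsFiniteMeasure (volume.restrict (A ∩ Ico 0 r)) := ⟨by simpa using (hfin r).lt_top⟩
  have heq : volume.restrict (A ∩ Ico 0 r) = ENNReal.ofReal ρ • volume.restrict (Ico 0 r) := by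
    refine Measure.ext_of_Iic _ _ fun a => ?_
    have hset : Iio a ∩ Ico 0 r = Ico 0 (min a r) := by ext; simp; tauto
    rw [Measure.smul_apply, ← measure_congr (Iio_ae_eq_Iic (a := a)),
      ← measure_congr (Iio_ae_eq_Iic (a := a)), Measure.restrict_apply measurableSet_Iio,
      Measure.restrict_apply measurableSet_Iio, inter_left_comm, hset, smul_eq_mul]
    rcases le_total 0 a with ha | ha
    · exact hlin' _ ⟨le_min ha hrpos.le, min_le_right _ _⟩
    · rw [Ico_eq_empty (by simp [ha])]
      simp
  have hA2 := congrArg (fun m => m A) heq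
  simp only [Measure.smul_apply, smul_eq_mul, Measure.restrict_apply hA, ← inter_assoc,
    inter_self] at hA2
  by_cases h : volume (A ∩ Ico 0 r) = 0
  · exact .inl h
  right
  have hone : ENNReal.ofReal ρ = 1 := by
    rwa [eq_comm, ENNReal.mul_eq_right h (hfin r)] at hA2
  have hAc := congrArg (fun m => m Aᶜ) heq
  simpa [hone, Measure.restrict_apply hA.compl, ← inter_assoc] using hAc.symm

theorem preErgodic_greedyMap : PreErgodic (greedyMap q₀ q₁) (greedyMeasure q₀ q₁) := by
  refine ⟨fun A hA hinv => ?_⟩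
  rw [eventuallyConst_set']
  rcases volume_inter_or_compl_inter_eq_zero h₀ h₁ hQ hA hinv with h | h
  · exact .inl (ae_eq_empty.2 (greedyMeasure_eq_zero h₀ h₁ hQ hA h))
  · exact .inr (ae_eq_univ.2 (greedyMeasure_eq_zero h₀ h₁ hQ hA.compl h))

/-! ### Absorption into `[0, r_Q]` and uniqueness -/

omit hQ in
-- Above `r_Q > 1/q₁` only the upper branch acts, and it expands distances from its fixed point
-- `1/(q₁ - 1)` by `q₁`.
theorem iterate_greedyMap_of_lt {x : ℝ} {n : ℕ}
    (h : ∀ k < n, rPoint q₀ q₁ < (greedyMap q₀ q₁)^[k] x) :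
    1 / (q₁ - 1) - (greedyMap q₀ q₁)^[n] x = q₁ ^ n * (1 / (q₁ - 1) - x) := by
  induction n with
  | zero => simp
  | succ n ih =>
    have hp : q₁ - 1 ≠ 0 := by linarith
    have hn := (one_div_lt_rPoint h₀ h₁).trans (h n n.lt_succ_self)
    rw [Function.iterate_succ_apply', greedyMap, if_neg hn.not_gt, pow_succ', mul_assoc,
      ← ih fun k hk => h k (hk.trans n.lt_succ_self)]
    field_simp
    ring

omit hQ in
theorem exists_iterate_greedyMap_le {x : ℝ} (hx : x < 1 / (q₁ - 1)) :
    ∃ n, (greedyMap q₀ q₁)^[n] x ≤ rPoint q₀ q₁ := by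
  by_contra! h
  have hpos : 0 < 1 / (q₁ - 1) - x := sub_pos.2 hx
  obtain ⟨n, hn⟩ := pow_unbounded_of_one_lt (1 / (q₁ - 1) / (1 / (q₁ - 1) - x)) h₁
  rw [div_lt_iff₀ hpos, ← iterate_greedyMap_of_lt h₀ h₁ fun k _ => h k] at hn
  linarith [h n, rPoint_pos h₀ h₁]

/-- Almost every point above `r_Q` must return there infinitely often, yet its orbit enters `[0,
r_Q]` and never leaves. The fixed endpoint `1/(q₁ - 1)` escapes this argument but is null. -/
theorem IsACInvariant.absolutelyContinuous_greedyMeasure {ν : Measure ℝ}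
    (hν : IsACInvariant (interval q₁) (greedyMap q₀ q₁) ν) : ν ≪ greedyMeasure q₀ q₁ := by
  have := hν.prob
  have hI : ∀ᵐ x ∂ν, x ∈ interval q₁ :=
    hν.ac.ae_le (ae_restrict_mem measurableSet_Icc)
  have hpt : ∀ a : ℝ, ∀ᵐ x ∂ν, x ≠ a := fun a =>
    hν.ac.ae_le (Measure.ae_ne _ a)
  have hrec := hν.inv.conservative.ae_mem_imp_frequently_image_mem
    (measurableSet_Ioi (a := rPoint q₀ q₁)).nullMeasurableSet
  have hlt : ∀ᵐ x ∂ν, x ∈ Ico 0 (rPoint q₀ q₁) := by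
    filter_upwards [hI, hpt (1 / (q₁ - 1)), hpt (rPoint q₀ q₁), hrec] with x hx hne hne' hfr
    refine ⟨hx.1, lt_of_le_of_ne (not_lt.1 fun hlt => ?_) hne'⟩
    obtain ⟨n, hn⟩ := exists_iterate_greedyMap_le h₀ h₁ (lt_of_le_of_ne hx.2 hne)
    have hmem : (greedyMap q₀ q₁)^[n] x ∈ Icc 0 (rPoint q₀ q₁) :=
      ⟨((mapsTo_greedyMap h₀ h₁ hQ).iterate n hx).1, hn⟩
    obtain ⟨m, hm, hm'⟩ := (frequently_atTop.1 (hfr hlt)) n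
    obtain ⟨k, rfl⟩ := Nat.exists_eq_add_of_le' hm
    rw [Function.iterate_add_apply] at hm'
    exact not_lt.2 ((mapsTo_greedyMap_Icc h₀ h₁ hQ).iterate k hmem).2 hm'
  refine Measure.AbsolutelyContinuous.mk fun s hs h0 => ?_
  have hv : volume (s ∩ Ico 0 (rPoint q₀ q₁)) = 0 :=
    le_antisymm ((volume_inter_le_greedyMeasure h₀ h₁ hQ hs).trans h0.le) zero_le
  have hν0 : ν (s ∩ Ico 0 (rPoint q₀ q₁)) = 0 :=
    hν.ac (Measure.absolutelyContinuous_of_le Measure.restrict_le_self hv)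
  rw [← hν0]
  refine measure_congr ?_
  filter_upwards [hlt] with x hx
  exact propext ⟨fun h => ⟨h, hx⟩, fun h => h.1⟩

/-- The normalized greedy measure is the unique absolutely continuous invariant probability
measure of the greedy map. -/
theorem exists_unique_greedy :
    ∃ c : ℝ, 0 < c ∧
      IsACInvariant (interval q₁) (greedyMap q₀ q₁)
        ((volume.restrict (interval q₁)).withDensity
          fun x => ENNReal.ofReal (c * greedyStep q₀ q₁ x)) ∧
      ∀ ν : Measure ℝ, IsACInvariant (interval q₁) (greedyMap q₀ q₁) ν →
        ν = (volume.restrict (interval q₁)).withDensity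
          fun x => ENNReal.ofReal (c * greedyStep q₀ q₁ x) := by
  have htop := greedyMeasure_univ_ne_top h₀ h₁ hQ
  have hzero := greedyMeasure_univ_ne_zero h₀ h₁ hQ
  have hM : 0 < (greedyMeasure q₀ q₁ univ).toReal := ENNReal.toReal_pos hzero htop
  have hμ : (volume.restrict (interval q₁)).withDensity
      (fun x => ENNReal.ofReal ((greedyMeasure q₀ q₁ univ).toReal⁻¹ * greedyStep q₀ q₁ x)) =
      (greedyMeasure q₀ q₁ univ)⁻¹ • greedyMeasure q₀ q₁ := by
    simp_rw [ENNReal.ofReal_mul (inv_pos.2 hM).le, ENNReal.ofReal_inv_of_pos hM,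
      ENNReal.ofReal_toReal htop]
    exact withDensity_smul _ (measurable_ofReal_greedyStep h₀ h₁)
  have : IsProbabilityMeasure ((greedyMeasure q₀ q₁ univ)⁻¹ • greedyMeasure q₀ q₁) :=
    ⟨by simp [ENNReal.inv_mul_cancel hzero htop]⟩
  have hpres := (measurePreserving_greedyMap h₀ h₁ hQ).smul_measure (greedyMeasure q₀ q₁ univ)⁻¹
  refine ⟨(greedyMeasure q₀ q₁ univ).toReal⁻¹, inv_pos.2 hM, ?_, fun ν hν => ?_⟩
  · refine ⟨?_, withDensity_absolutelyContinuous _ _, ?_⟩ <;> rwa [hμ]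
  · rw [hμ]
    have := hν.prob
    refine Ergodic.eq_of_absolutelyContinuous
      ⟨hpres, (preErgodic_greedyMap h₀ h₁ hQ).smul_measure _⟩ hν.inv ?_
    exact (hν.absolutelyContinuous_greedyMeasure h₀ h₁ hQ).trans
      (Measure.absolutelyContinuous_smul (by simp [htop]))

end

/-! ### The lazy map, by reflection -/

theorem IsACInvariant.map {I J : Set ℝ} {T S : ℝ → ℝ} {ν : Measure ℝ}
    (hν : IsACInvariant I T ν) (e : ℝ ≃ᵐ ℝ) (hS : Measurable S)
    (he : volume.map e ≪ volume) (hIJ : e ⁻¹' J = I) (hTS : ∀ x, S (e x) = e (T x)) :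
    IsACInvariant J S (ν.map e) := by
  have := hν.prob
  refine ⟨Measure.isProbabilityMeasure_map e.measurable.aemeasurable, ?_, hS, ?_⟩
  · refine (hν.ac.map e.measurable).trans ?_
    rw [← hIJ, ← e.restrict_map]
    exact he.restrict J
  · rw [Measure.map_map hS e.measurable, show S ∘ e = e ∘ T from funext hTS,
      ← Measure.map_map e.measurable hν.inv.measurable, hν.inv.map_eq]

theorem measurable_lazyMap (q₀ q₁ : ℝ) : Measurable (lazyMap q₀ q₁) :=
  Measurable.ite measurableSet_Iic (by fun_prop) (by fun_prop)

/-- The order-reversing affine bijection from `I_{(q₀, q₁)}` onto `I_{(q₁, q₀)}`. It conjugates the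
lazy map of the base `(q₀, q₁)` to the greedy map of the base `(q₁, q₀)`. -/
noncomputable def reflection (q₀ q₁ : ℝ) (x : ℝ) : ℝ := (1 - (q₁ - 1) * x) / (q₀ - 1)

theorem measurable_reflection (q₀ q₁ : ℝ) : Measurable (reflection q₀ q₁) := by
  unfold reflection; fun_prop

section

variable {q₀ q₁ : ℝ} (h₀ : 1 < q₀) (h₁ : 1 < q₁)

include h₀ h₁

theorem reflection_reflection (x : ℝ) : reflection q₁ q₀ (reflection q₀ q₁ x) = x := by
  have : q₀ - 1 ≠ 0 := by linarith
  have : q₁ - 1 ≠ 0 := by linarith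
  unfold reflection
  field_simp
  ring

/-- The reflection as a measurable equivalence. -/
noncomputable def reflectionEquiv : ℝ ≃ᵐ ℝ where
  toFun := reflection q₀ q₁
  invFun := reflection q₁ q₀
  left_inv := reflection_reflection h₀ h₁
  right_inv := reflection_reflection h₁ h₀
  measurable_toFun := measurable_reflection q₀ q₁
  measurable_invFun := measurable_reflection q₁ q₀

theorem volume_preimage_reflection (s : Set ℝ) :
    volume (reflection q₀ q₁ ⁻¹' s) = ENNReal.ofReal ((q₀ - 1) / (q₁ - 1)) * volume s := by
  have h : 0 < (q₁ - 1) / (q₀ - 1) := div_pos (by linarith) (by linarith)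
  have : reflection q₀ q₁ ⁻¹' s =
      (fun x => (q₁ - 1) / (q₀ - 1) * x - 1 / (q₀ - 1)) ⁻¹' ((fun x => -x) ⁻¹' s) := by
    ext x
    simp only [mem_preimage, reflection]
    rw [show (1 - (q₁ - 1) * x) / (q₀ - 1) =
      -((q₁ - 1) / (q₀ - 1) * x - 1 / (q₀ - 1)) by ring]
  rw [this, volume_preimage_mul_sub h, inv_div, Measure.measure_preimage_neg]

theorem reflection_nonneg_iff {x : ℝ} : 0 ≤ reflection q₀ q₁ x ↔ x ≤ 1 / (q₁ - 1) := by
  have h0 : 0 < q₀ - 1 := by linarith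
  have h1 : 0 < q₁ - 1 := by linarith
  rw [reflection, le_div_iff₀ h0, le_div_iff₀ h1, zero_mul, sub_nonneg, mul_comm]

theorem reflection_lt_reflection_iff {x y : ℝ} :
    reflection q₀ q₁ x < reflection q₀ q₁ y ↔ y < x := by
  have h0 : 0 < q₀ - 1 := by linarith
  have h1 : 0 < q₁ - 1 := by linarith
  rw [reflection, reflection, div_lt_div_iff_of_pos_right h0, sub_lt_sub_iff_left,
    mul_lt_mul_iff_right₀ h1]

theorem reflection_preimage_interval : reflection q₀ q₁ ⁻¹' interval q₀ = interval q₁ := by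
  have h0 : 0 < q₀ - 1 := by linarith
  have h1 : 0 < q₁ - 1 := by linarith
  ext x
  simp only [interval, mem_preimage, mem_Icc, reflection_nonneg_iff h₀ h₁]
  rw [and_comm, and_congr_left_iff]
  intro _
  rw [reflection, div_le_div_iff_of_pos_right h0, sub_le_self_iff, mul_nonneg_iff_of_pos_left h1]

theorem reflection_lt_one_div_iff {x : ℝ} :
    reflection q₀ q₁ x < 1 / q₀ ↔ 1 / (q₀ * (q₁ - 1)) < x := by
  have h0 : q₀ - 1 ≠ 0 := by linarith
  have h1 : q₁ - 1 ≠ 0 := by linarith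
  have : reflection q₀ q₁ (1 / (q₀ * (q₁ - 1))) = 1 / q₀ := by
    unfold reflection; field_simp
  rw [← this, reflection_lt_reflection_iff h₀ h₁]

theorem reflection_lazyMap (x : ℝ) :
    greedyMap q₁ q₀ (reflection q₀ q₁ x) = reflection q₀ q₁ (lazyMap q₀ q₁ x) := by
  have h0 : q₀ - 1 ≠ 0 := by linarith
  have h1 : q₁ - 1 ≠ 0 := by linarith
  rw [greedyMap, lazyMap]
  by_cases h : x ≤ 1 / (q₀ * (q₁ - 1))
  · rw [if_pos h, if_neg (by rwa [reflection_lt_one_div_iff h₀ h₁, not_lt])]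
    unfold reflection
    field_simp
    ring
  · rw [if_neg h, if_pos (by rwa [reflection_lt_one_div_iff h₀ h₁, ← not_le])]
    unfold reflection
    field_simp
    ring

theorem reflection_lPoint : reflection q₀ q₁ (lPoint q₀ q₁) = rPoint q₁ q₀ := by
  have h0 : q₀ - 1 ≠ 0 := by linarith
  have h1 : q₁ - 1 ≠ 0 := by linarith
  unfold reflection lPoint rPoint
  field_simp
  ring

theorem reflection_iterate_lazyMap (n : ℕ) :
    reflection q₀ q₁ ((lazyMap q₀ q₁)^[n] (lPoint q₀ q₁)) = greedyOrbit q₁ q₀ n := by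
  induction n with
  | zero => exact reflection_lPoint h₀ h₁
  | succ n ih =>
    rw [Function.iterate_succ_apply', ← reflection_lazyMap h₀ h₁, ih, greedyOrbit_succ]

/-- Reversing the order also matches the strict inequality of one map with the weak one of the
other, so digits are exchanged even at the discontinuity. -/
theorem greedySum_add_lazySum (n : ℕ) : greedySum q₁ q₀ n + lazySum q₀ q₁ n = n := by
  rw [greedySum, lazySum, ← Finset.sum_add_distrib]
  conv_rhs => rw [← Finset.card_range n, Finset.card_eq_sum_ones]
  refine Finset.sum_congr rfl fun i _ => ?_
  have := reflection_iterate_lazyMap h₀ h₁ i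
  rw [greedyOrbit] at this
  rw [greedyDigit, lazyDigit, ← this]
  simp only [reflection_lt_one_div_iff h₀ h₁, ← not_le]
  split_ifs <;> rfl

theorem lazyTerm_eq (x : ℝ) : lazyTerm q₀ q₁ x = greedyTerm q₁ q₀ (reflection q₀ q₁ x) := by
  funext n
  have hs := greedySum_add_lazySum h₀ h₁ n
  have hmem : x ∈ Ioc ((lazyMap q₀ q₁)^[n] (lPoint q₀ q₁)) (1 / (q₁ - 1)) ↔
      reflection q₀ q₁ x ∈ Ico 0 ((greedyMap q₁ q₀)^[n] (rPoint q₁ q₀)) := by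
    have := reflection_iterate_lazyMap h₀ h₁ n
    rw [greedyOrbit] at this
    rw [mem_Ioc, mem_Ico, ← this, reflection_lt_reflection_iff h₀ h₁,
      reflection_nonneg_iff h₀ h₁, and_comm]
  rw [lazyTerm, greedyTerm, show n - lazySum q₀ q₁ n = greedySum q₁ q₀ n by lia,
    show n - greedySum q₁ q₀ n = lazySum q₀ q₁ n by lia]
  simp only [indicator, hmem]

theorem lazyStep_eq (x : ℝ) : lazyStep q₀ q₁ x = greedyStep q₁ q₀ (reflection q₀ q₁ x) := by
  rw [lazyStep, greedyStep, lazyTerm_eq h₀ h₁]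

theorem map_reflection_volume :
    volume.map (reflection q₀ q₁) = ENNReal.ofReal ((q₀ - 1) / (q₁ - 1)) • volume := by
  ext s hs
  rw [Measure.map_apply (measurable_reflection q₀ q₁) hs, volume_preimage_reflection h₀ h₁]
  rfl

theorem isACInvariant_lazyMap_map {ν : Measure ℝ}
    (hν : IsACInvariant (interval q₀) (greedyMap q₁ q₀) ν) :
    IsACInvariant (interval q₁) (lazyMap q₀ q₁) (ν.map (reflection q₁ q₀)) := by
  refine hν.map (reflectionEquiv h₁ h₀) (measurable_lazyMap q₀ q₁) ?_
    (reflection_preimage_interval h₁ h₀) fun x => ?_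
  · refine Measure.absolutelyContinuous_of_eq (map_reflection_volume h₁ h₀) |>.trans ?_
    exact Measure.smul_absolutelyContinuous
  · change lazyMap q₀ q₁ (reflection q₁ q₀ x) = reflection q₁ q₀ (greedyMap q₁ q₀ x)
    rw [← reflection_reflection h₀ h₁ (lazyMap q₀ q₁ (reflection q₁ q₀ x)),
      ← reflection_lazyMap h₀ h₁, reflection_reflection h₁ h₀]

theorem isACInvariant_greedyMap_map {ν : Measure ℝ}
    (hν : IsACInvariant (interval q₁) (lazyMap q₀ q₁) ν) :
    IsACInvariant (interval q₀) (greedyMap q₁ q₀) (ν.map (reflection q₀ q₁)) := by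
  refine hν.map (reflectionEquiv h₀ h₁) (measurable_greedyMap q₁ q₀) ?_
    (reflection_preimage_interval h₀ h₁) (reflection_lazyMap h₀ h₁)
  refine Measure.absolutelyContinuous_of_eq (map_reflection_volume h₀ h₁) |>.trans ?_
  exact Measure.smul_absolutelyContinuous

theorem measurable_ofReal_mul_greedyStep (c : ℝ) (hc : 0 ≤ c) :
    Measurable fun x => ENNReal.ofReal (c * greedyStep q₀ q₁ x) := by
  simp_rw [ENNReal.ofReal_mul hc]
  exact (measurable_ofReal_greedyStep h₀ h₁).const_mul _

/-- The factor `(q₁ - 1) / (q₀ - 1)` comes from the change of variables. -/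
theorem map_reflection_withDensity {c : ℝ} (hc : 0 ≤ c) :
    ((volume.restrict (interval q₀)).withDensity
      fun x => ENNReal.ofReal (c * greedyStep q₁ q₀ x)).map (reflection q₁ q₀) =
    (volume.restrict (interval q₁)).withDensity
      fun x => ENNReal.ofReal ((q₁ - 1) / (q₀ - 1) * c * lazyStep q₀ q₁ x) := by
  have hk : 0 ≤ (q₁ - 1) / (q₀ - 1) := div_nonneg (by linarith) (by linarith)
  have hvol : (volume.restrict (interval q₀)).map (reflection q₁ q₀) =
      ENNReal.ofReal ((q₁ - 1) / (q₀ - 1)) • volume.restrict (interval q₁) := by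
    rw [← reflection_preimage_interval h₁ h₀, ← Measure.restrict_map (measurable_reflection q₁ q₀)
      (show MeasurableSet (interval q₁) from measurableSet_Icc), map_reflection_volume h₁ h₀, Measure.restrict_smul]
  have hg : Measurable fun x => ENNReal.ofReal (c * greedyStep q₁ q₀ (reflection q₀ q₁ x)) :=
    (measurable_ofReal_mul_greedyStep h₁ h₀ c hc).comp (measurable_reflection q₀ q₁)
  ext s hs
  rw [Measure.map_apply (measurable_reflection q₁ q₀) hs,
    withDensity_apply _ (measurable_reflection q₁ q₀ hs), withDensity_apply _ hs]
  simp_rw [lazyStep_eq h₀ h₁, mul_assoc, ENNReal.ofReal_mul hk]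
  rw [lintegral_const_mul _ hg, ← smul_eq_mul,
    ← lintegral_smul_measure, ← Measure.restrict_smul, ← hvol, setLIntegral_map hs hg
    (measurable_reflection q₁ q₀)]
  simp only [reflection_reflection h₁ h₀]

variable (hQ : q₀ * q₁ ≤ q₀ + q₁)

include hQ

/-- The reflected greedy measure is the unique absolutely continuous invariant probability
measure of the lazy map. -/
theorem exists_unique_lazy :
    ∃ c : ℝ, 0 < c ∧
      IsACInvariant (interval q₁) (lazyMap q₀ q₁)
        ((volume.restrict (interval q₁)).withDensity
          fun x => ENNReal.ofReal (c * lazyStep q₀ q₁ x)) ∧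
      ∀ ν : Measure ℝ, IsACInvariant (interval q₁) (lazyMap q₀ q₁) ν →
        ν = (volume.restrict (interval q₁)).withDensity
          fun x => ENNReal.ofReal (c * lazyStep q₀ q₁ x) := by
  -- The hypothesis on the base is symmetric in `q₀` and `q₁`.
  obtain ⟨c, hc, hinv, huniq⟩ := exists_unique_greedy h₁ h₀ (by linarith)
  refine ⟨(q₁ - 1) / (q₀ - 1) * c, mul_pos (div_pos (by linarith) (by linarith)) hc, ?_,
    fun ν hν => ?_⟩ <;> rw [← map_reflection_withDensity h₀ h₁ hc.le]
  · exact isACInvariant_lazyMap_map h₀ h₁ hinv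
  · rw [← huniq _ (isACInvariant_greedyMap_map h₀ h₁ hν),
      Measure.map_map (measurable_reflection q₁ q₀) (measurable_reflection q₀ q₁),
      show reflection q₁ q₀ ∘ reflection q₀ q₁ = id from
        funext (reflection_reflection h₀ h₁), Measure.map_id]

end

end DoubleBase

theorem theorem1p3 (q₀ q₁ : ℝ) (h₀ : 1 < q₀) (h₁ : 1 < q₁) (hQ : q₀ * q₁ ≤ q₀ + q₁) :
    ((∀ x : ℝ, Summable (DoubleBase.greedyTerm q₀ q₁ x)) ∧
      ∃ μ : Measure ℝ,
        DoubleBase.IsACInvariant (DoubleBase.interval q₁) (DoubleBase.greedyMap q₀ q₁) μ ∧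
        (∀ ν : Measure ℝ,
          DoubleBase.IsACInvariant (DoubleBase.interval q₁) (DoubleBase.greedyMap q₀ q₁) ν →
            ν = μ) ∧
        ∃ c : ℝ, 0 < c ∧
          μ.rnDeriv (volume.restrict (DoubleBase.interval q₁))
            =ᵐ[volume.restrict (DoubleBase.interval q₁)]
              fun x => ENNReal.ofReal (c * DoubleBase.greedyStep q₀ q₁ x)) ∧
    ((∀ x : ℝ, Summable (DoubleBase.lazyTerm q₀ q₁ x)) ∧
      ∃ μ : Measure ℝ,
        DoubleBase.IsACInvariant (DoubleBase.interval q₁) (DoubleBase.lazyMap q₀ q₁) μ ∧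
        (∀ ν : Measure ℝ,
          DoubleBase.IsACInvariant (DoubleBase.interval q₁) (DoubleBase.lazyMap q₀ q₁) ν →
            ν = μ) ∧
        ∃ c : ℝ, 0 < c ∧
          μ.rnDeriv (volume.restrict (DoubleBase.interval q₁))
            =ᵐ[volume.restrict (DoubleBase.interval q₁)]
              fun x => ENNReal.ofReal (c * DoubleBase.lazyStep q₀ q₁ x)) := by

  have hm := DoubleBase.measurable_ofReal_mul_greedyStep h₀ h₁
  obtain ⟨c, hc, hinv, huniq⟩ := DoubleBase.exists_unique_greedy h₀ h₁ hQ
  obtain ⟨c', hc', hinv', huniq'⟩ := DoubleBase.exists_unique_lazy h₀ h₁ hQ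
  refine ⟨⟨DoubleBase.summable_greedyTerm h₀ h₁, _, hinv, huniq, c, hc,
    Measure.rnDeriv_withDensity _ (hm c hc.le)⟩, fun x => ?_, _, hinv', huniq', c', hc',
    Measure.rnDeriv_withDensity _ ?_⟩
  · rw [DoubleBase.lazyTerm_eq h₀ h₁]
    exact DoubleBase.summable_greedyTerm h₁ h₀ _
  · simp_rw [DoubleBase.lazyStep_eq h₀ h₁]
    exact (DoubleBase.measurable_ofReal_mul_greedyStep h₁ h₀ c' hc'.le).comp
      (DoubleBase.measurable_reflection q₀ q₁)
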